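/- Let $F$ be a finite field with $F\neq\mathbb F_2$ and let $V$ be a finite-dimensional vector space over $F$. Let $\varphi$ be one of the following forms on $V$, and let $n$ be its Witt index, that is, the largest dimension of a totally isotropic subspace of $V$ (for a quadratic form: of a subspace on which the form vanishes identically): 1. a non-degenerate alternating bilinear form, with $n\ge 2$; 2. a non-degenerate quadratic form, with $n\ge 3$ (in any characteristic; non-degenerate means that no non-zero vector of the radical of the polar bilinear form is singular); 3. a non-degenerate hermitian form with respect to an automorphism of $F$ of order $2$, with $n\ge 3$. Let $\Omega\subseteq\mathrm{PG}(\bigwedge^2V)$ be the set of the points $[v_1\wedge v_2]$, where $\langle v_1,v_2\rangle$ ranges over the $2$-dimensional totally isotropic subspaces of $V$. For each $\omega\in\Omega$ choose a vector $w_\omega$ representing $\omega$, and let $$\mathcal C=\{(\xi(w_\omega))_{\omega\in\Omega} : \xi\in(\textstyle\bigwedge^2V)^*\}\subseteq F^{\Omega}.$$ This is the line symplectic, line orthogonal or line hermitian Grassmann code, in cases 1, 2 and 3 respectively. Then $\mathcal C$ is a minimal code: if $c,c'\in\mathcal C$ and $\mathrm{supp}(c')\subseteq\mathrm{supp}(c)$,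 then $c'=\lambda c$ for some $\lambda\in F$. -/

import Mathlib

open scoped LinearAlgebra.Projectivization

noncomputable section

/-! ### Linear codes and minimality -/

/-- A codeword `c` of the linear code `C` is minimal if every codeword of `C` whose support is
contained in the support of `c` is a scalar multiple of `c`. -/
def IsMinimalCodeword {F ι : Type*} [Field F] (C : Submodule F (ι → F)) (c : ι → F) : Prop :=
  ∀ c' ∈ C, Function.support c' ⊆ Function.support c → ∃ a : F, c' = a • c

/-- A linear code is minimal if all its codewords are minimal. -/
def IsMinimalCode {F ι : Type*} [Field F] (C : Submodule F (ι → F)) : Prop :=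
  ∀ c ∈ C, IsMinimalCodeword C c

/-! ### The code of a projective system -/

/-- The linear code of a set `Ω` of points of the projective space `PG(W)`. Its positions are the
points of `Ω`, and its codewords are the words `(ξ(w_ω))_ω`, where `w_ω` is a representative vector
of `ω` and `ξ` is a linear form. This is the row space of a matrix whose columns are coordinates of
the `w_ω`; as every linear form on `⟨Ω⟩` extends to `W`, it does not matter whether the coordinates
are taken in `W` or in `⟨Ω⟩`. -/
def projectiveCode {F W : Type*} [Field F] [AddCommGroup W] [Module F W] (Ω : Set (ℙ F W)) :
    Submodule F (Ω → F) :=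
  LinearMap.range
    (LinearMap.pi (fun ω : Ω => LinearMap.applyₗ (ω : ℙ F W).rep) :
      Module.Dual F W →ₗ[F] (Ω → F))

/-! ### The Grassmann (Plücker) embedding -/

/-- The image under the Grassmann embedding `⟨v₁, …, v_k⟩ ↦ [v₁ ∧ ⋯ ∧ v_k]` of the set of all
`k`-dimensional subspaces that belong to the family `S`. -/
def grassmannImage {F V : Type*} [Field F] [AddCommGroup V] [Module F V] (k : ℕ)
    (S : Set (Submodule F V)) : Set (ℙ F (⋀[F]^k V)) :=
  {P | ∃ v : Fin k → V, LinearIndependent F v ∧ Submodule.span F (Set.range v) ∈ S ∧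
    P.submodule = Submodule.span F {exteriorPower.ιMulti F k v}}

/-! ### Totally isotropic subspaces, polar Grassmann codes -/

/-- The subspaces that are totally isotropic for a reflexive sesquilinear (for instance an
alternating or a hermitian) form. -/
def totallyIsotropic {F V : Type*} [Field F] [AddCommGroup V] [Module F V] {σ : F →+* F}
    (φ : V →ₛₗ[σ] V →ₗ[F] F) : Set (Submodule F V) :=
  {X | ∀ x ∈ X, ∀ y ∈ X, φ x y = 0}

/-- The subspaces on which a quadratic form vanishes identically. -/
def totallySingular {F V : Type*} [Field F] [AddCommGroup V] [Module F V]
    (Q : QuadraticForm F V) : Set (Submodule F V) :=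
  {X | ∀ x ∈ X, Q x = 0}

/-- The Witt index: the largest dimension of a member of the family `S` of totally isotropic
subspaces of a finite-dimensional space. -/
def wittIndex {F V : Type*} [Field F] [AddCommGroup V] [Module F V]
    (S : Set (Submodule F V)) : ℕ :=
  sSup ((fun X : Submodule F V => Module.finrank F X) '' S)

/-- The polar `k`-Grassmann code of the polar space with family `S` of totally isotropic subspaces:
the code of the image of the totally isotropic `k`-dimensional subspaces in `PG(⋀^k V)`. -/
def polarGrassmannCode {F V : Type*} [Field F] [AddCommGroup V] [Module F V] (k : ℕ)
    (S : Set (Submodule F V)) : Submodule F (grassmannImage k S → F) :=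
  projectiveCode (grassmannImage k S)

end

/-!
A codeword is the restriction to the totally isotropic pairs `(x, y)` of an alternating form `A`,
so let `B` be a second alternating form vanishing on every totally isotropic pair on which `A` does.
Fix a singular vector `p`. Modulo `p`, the singular vectors orthogonal to `p` form a polar space, on
which `A p` and `B p` are linear forms, the second vanishing wherever the first does. As the
complement of a hyperplane of a polar space is connected, `B p` is a multiple of `A p` there. The
factor does not depend on `p`: it is the same for `p` and `w` if they are orthogonal and
`A p w ≠ 0`, and since a polar space is not the union of two hyperplanes, any two `p`, `q` can be
joined by a chain of such steps.
-/

section Quadrangles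

variable {F V : Type*} [Field F] [AddCommGroup V] [Module F V] {S : Set V} {f g : V →ₗ[F] F}
  {x y z : V}

/-- Two vectors are collinear in a set `S` of vectors if `S` contains every vector they span.
This includes the degenerate cases where `x` and `y` are linearly dependent. -/
def IsCollinear (F : Type*) {V : Type*} [Field F] [AddCommGroup V] [Module F V] (S : Set V)
    (x y : V) : Prop :=
  ∀ a b : F, a • x + b • y ∈ S

namespace IsCollinear

theorem left_mem (h : IsCollinear F S x y) : x ∈ S := by simpa using h 1 0

theorem right_mem (h : IsCollinear F S x y) : y ∈ S := by simpa using h 0 1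

theorem add_mem (h : IsCollinear F S x y) : x + y ∈ S := by simpa using h 1 1

theorem mul_eq_mul (h : IsCollinear F S x y) (hfg : ∀ v ∈ S, f v = 0 → g v = 0) :
    g x * f y = g y * f x := by
  have hg : g (f y • x + -f x • y) = 0 := hfg _ (h _ _) (by simp; ring)
  simp only [map_add, map_smul, smul_eq_mul] at hg
  linear_combination hg

theorem exists_ne_zero_and_ne_zero (h : IsCollinear F S x y) (hf : f x ≠ 0) (hg : g y ≠ 0) :
    ∃ w ∈ S, f w ≠ 0 ∧ g w ≠ 0 := by
  by_cases hfy : f y = 0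
  · by_cases hgx : g x = 0
    · exact ⟨x + y, h.add_mem, by simpa [hfy], by simpa [hgx]⟩
    · exact ⟨x, h.left_mem, hf, hgx⟩
  · exact ⟨y, h.right_mem, hfy, hg⟩

end IsCollinear

/-- Any two vectors `y`, `z` of `S` are opposite vertices of a (possibly degenerate) quadrangle
`y, u, z, u'` with collinear sides, two opposite sides of which are joined by a line through `y + u`
and `z + u'`. In this form the connectedness of the complements of hyperplanes covers polar spaces
and vector spaces alike. -/
def HasQuadrangles (F : Type*) {V : Type*} [Field F] [AddCommGroup V] [Module F V]
    (S : Set V) : Prop :=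
  ∀ y ∈ S, ∀ z ∈ S, ∃ u u' : V, IsCollinear F S y u ∧ IsCollinear F S u z ∧
    IsCollinear F S y u' ∧ IsCollinear F S u' z ∧ IsCollinear F S (y + u) (z + u')

namespace HasQuadrangles

theorem mul_eq_mul (hS : HasQuadrangles F S) (hfg : ∀ v ∈ S, f v = 0 → g v = 0) (hy : y ∈ S)
    (hz : z ∈ S) : g y * f z = g z * f y := by
  have through {v : V} (hyv : IsCollinear F S y v) (hvz : IsCollinear F S v z) (hv : f v ≠ 0) :
      g y * f z = g z * f y := by
    apply mul_right_cancel₀ hv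
    linear_combination f z * hyv.mul_eq_mul hfg + f y * hvz.mul_eq_mul hfg
  obtain ⟨u, u', hyu, huz, hyu', huz', huu⟩ := hS y hy z hz
  by_cases hu : f u = 0
  · by_cases hu' : f u' = 0
    · simpa [hu, hu', hfg u hyu.right_mem hu, hfg u' hyu'.right_mem hu'] using huu.mul_eq_mul hfg
    · exact through hyu' huz' hu'
  · exact through hyu huz hu

theorem exists_ne_zero_and_ne_zero (hS : HasQuadrangles F S) (hy : y ∈ S) (hfy : f y ≠ 0)
    (hz : z ∈ S) (hgz : g z ≠ 0) : ∃ w ∈ S, f w ≠ 0 ∧ g w ≠ 0 := by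
  obtain ⟨u, u', -, huz, hyu', -, huu⟩ := hS y hy z hz
  by_cases hfu : f u = 0
  · by_cases hgu' : g u' = 0
    · exact huu.exists_ne_zero_and_ne_zero (by simpa [hfu]) (by simpa [hgu'])
    · exact hyu'.exists_ne_zero_and_ne_zero hfy hgu'
  · exact huz.exists_ne_zero_and_ne_zero hfu hgz

end HasQuadrangles

theorem hasQuadrangles_coe (U : Submodule F V) : HasQuadrangles F (U : Set V) := by
  intro y hy z hz
  have hcol {v w : V} (hv : v ∈ U) (hw : w ∈ U) : IsCollinear F (U : Set V) v w := fun a b =>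
    U.add_mem (U.smul_mem a hv) (U.smul_mem b hw)
  exact ⟨0, 0, hcol hy U.zero_mem, hcol U.zero_mem hz, hcol hy U.zero_mem, hcol U.zero_mem hz,
    by simpa using hcol hy hz⟩

end Quadrangles

section PolarSpace

variable {F V : Type*} [Field F] [AddCommGroup V] [Module F V] {σ : F →+* F}
  {φ : V →ₛₗ[σ] V →ₗ[F] F} {S : Set V}

/-- The set `S` of vectors is the set of singular vectors of a nondegenerate polar space with
associated sesquilinear form `φ`. This treats alternating, quadratic and hermitian forms uniformly.
Only the span of `S` matters, so that the notion passes to `S ∩ {p, q}ᗮ`. -/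
structure IsPolarSpace (φ : V →ₛₗ[σ] V →ₗ[F] F) (S : Set V) : Prop where
  isRefl : φ.IsRefl
  smul_mem : ∀ (a : F) {x}, x ∈ S → a • x ∈ S
  add_mem : ∀ {x y}, x ∈ S → y ∈ S → φ x y = 0 → x + y ∈ S
  apply_self : ∀ {x}, x ∈ S → φ x x = 0
  exists_add_smul_mem : ∀ {x w}, x ∈ S → w ∈ Submodule.span F S → φ x w ≠ 0 →
    ∃ c : F, w + c • x ∈ S
  exists_apply_ne_zero : ∀ {x}, x ∈ S → x ≠ 0 → ∃ w ∈ S, φ x w ≠ 0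

/-- The subspace `{x, y}ᗮ` of the vectors orthogonal to both `x` and `y`. If `x` and `y` are
singular and not orthogonal, it is a model of the quotient of the orthogonal space of `x` by the
span of `x`. -/
def perpPair (φ : V →ₛₗ[σ] V →ₗ[F] F) (x y : V) : Submodule F V :=
  LinearMap.ker (φ x) ⊓ LinearMap.ker (φ y)

theorem mem_perpPair {x y w : V} : w ∈ perpPair φ x y ↔ φ x w = 0 ∧ φ y w = 0 := by
  simp [perpPair]

theorem perpPair_comm (x y : V) : perpPair φ x y = perpPair φ y x :=
  inf_comm _ _

/-- The subspace `X` is totally singular in the polar space with set `S` of singular vectors and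
form `φ`. Neither condition implies the other: all vectors are singular for an alternating form,
and in characteristic `2` the polar form of a quadratic form is alternating. -/
def IsTotallySingular (φ : V →ₛₗ[σ] V →ₗ[F] F) (S : Set V) (X : Submodule F V) : Prop :=
  (X : Set V) ⊆ S ∧ X ∈ totallyIsotropic φ

namespace IsPolarSpace

variable {p q x y z : V}

theorem apply_ne_zero_comm (h : IsPolarSpace φ S) : φ x y ≠ 0 ↔ φ y x ≠ 0 :=
  h.isRefl.eq_iff.not

theorem isCollinear (h : IsPolarSpace φ S) (hx : x ∈ S) (hy : y ∈ S) (hxy : φ x y = 0) :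
    IsCollinear F S x y := fun a b =>
  h.add_mem (h.smul_mem a hx) (h.smul_mem b hy) (by simp [hxy])

theorem inter_perpPair (h : IsPolarSpace φ S) (hy : y ∈ S) (hz : z ∈ S) (hyz : φ y z ≠ 0) :
    IsPolarSpace φ (S ∩ perpPair φ y z) where
  isRefl := h.isRefl
  smul_mem a _ hx := ⟨h.smul_mem a hx.1, Submodule.smul_mem _ a hx.2⟩
  add_mem hx hx' hxx' := ⟨h.add_mem hx.1 hx'.1 hxx', Submodule.add_mem _ hx.2 hx'.2⟩
  apply_self hx := h.apply_self hx.1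
  exists_add_smul_mem := fun {x w} hx hw hxw => by
    have hwU : w ∈ perpPair φ y z := Submodule.span_le.2 Set.inter_subset_right hw
    obtain ⟨c, hc⟩ :=
      h.exists_add_smul_mem hx.1 (Submodule.span_mono Set.inter_subset_left hw) hxw
    exact ⟨c, hc, Submodule.add_mem _ hwU (Submodule.smul_mem _ c hx.2)⟩
  exists_apply_ne_zero := fun {x} ⟨hx, hxU⟩ hx0 => by
    rw [SetLike.mem_coe, mem_perpPair] at hxU
    obtain ⟨w, hw, hxw⟩ := h.exists_apply_ne_zero hx hx0
    have hzy := h.apply_ne_zero_comm.1 hyz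
    -- the component of `w` orthogonal to the hyperbolic pair `y`, `z`
    set w' := w - (φ z w / φ z y) • y - (φ y w / φ y z) • z with hw'
    have hw'S : w' ∈ Submodule.span F S :=
      sub_mem (sub_mem (Submodule.subset_span hw)
        (Submodule.smul_mem _ _ (Submodule.subset_span hy)))
        (Submodule.smul_mem _ _ (Submodule.subset_span hz))
    have hxw' : φ x w' ≠ 0 := by
      simpa [hw', h.isRefl _ _ hxU.1, h.isRefl _ _ hxU.2] using hxw
    obtain ⟨c, hc⟩ := h.exists_add_smul_mem hx hw'S hxw'
    refine ⟨w' + c • x, ⟨hc, mem_perpPair.2 ⟨?_, ?_⟩⟩, by simpa [h.apply_self hx] using hxw'⟩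
    · simp [hw', hxU.1, h.apply_self hy, hyz]
    · simp [hw', hxU.2, h.apply_self hz, hzy]

theorem exists_sub_smul_mem_inter_perpPair (h : IsPolarSpace φ S) (hp : p ∈ S)
    (hpq : φ p q ≠ 0) (hy : y ∈ S) (hpy : φ p y = 0) :
    ∃ a : F, y - a • p ∈ S ∩ perpPair φ p q := by
  refine ⟨φ q y / φ q p, ?_, mem_perpPair.2 ⟨?_, ?_⟩⟩
  · simpa [sub_eq_add_neg] using h.isCollinear hy hp (h.isRefl _ _ hpy) 1 (-(φ q y / φ q p))
  · simp [hpy, h.apply_self hp]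
  · simp [h.apply_ne_zero_comm.1 hpq]

theorem hasQuadrangles (h : IsPolarSpace φ S)
    (hS : ∀ y ∈ S, ∀ z ∈ S, φ y z ≠ 0 → ∃ u ∈ S ∩ perpPair φ y z, u ≠ 0) :
    HasQuadrangles F S := by
  intro y hy z hz
  by_cases hyz : φ y z = 0
  · have h0 : (0 : V) ∈ S := by simpa using h.smul_mem 0 hy
    have hy0 := h.isCollinear hy h0 (by simp)
    have h0z := h.isCollinear h0 hz (by simp)
    exact ⟨0, 0, hy0, h0z, hy0, h0z, by simpa using h.isCollinear hy hz hyz⟩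
  obtain ⟨u, hu, hu0⟩ := hS y hy z hz hyz
  obtain ⟨v, hv, huv⟩ := (h.inter_perpPair hy hz hyz).exists_apply_ne_zero hu hu0
  -- the scalar for which `y + u` is orthogonal to `z + b • v`
  set b := -(φ y z / φ u v) with hb
  have hyu := mem_perpPair.1 hu.2
  have hbv : b • v ∈ S ∩ perpPair φ y z :=
    ⟨h.smul_mem b hv.1, Submodule.smul_mem _ b hv.2⟩
  have hyv := mem_perpPair.1 hbv.2
  refine ⟨u, b • v, h.isCollinear hy hu.1 hyu.1, h.isCollinear hu.1 hz (h.isRefl _ _ hyu.2),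
    h.isCollinear hy hbv.1 hyv.1, h.isCollinear hbv.1 hz (h.isRefl _ _ hyv.2),
    h.isCollinear (h.add_mem hy hu.1 hyu.1) (h.add_mem hz hbv.1 hyv.2) ?_⟩
  have hyv' : φ y v = 0 := (mem_perpPair.1 hv.2).1
  simp [hb, hyv', h.isRefl _ _ hyu.2, huv]

end IsPolarSpace

end PolarSpace

section Rank

variable {F V : Type*} [Field F] [AddCommGroup V] [Module F V] {σ : F →+* F}
  {φ : V →ₛₗ[σ] V →ₗ[F] F} {S : Set V} {X : Submodule F V} {y z : V}

theorem finrank_le_finrank_inf_ker_add_one (X : Submodule F V) (f : V →ₗ[F] F) :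
    Module.finrank F X ≤ Module.finrank F ↥(X ⊓ LinearMap.ker f) + 1 := by
  by_cases hX : FiniteDimensional F X
  · have hker : Module.finrank F (LinearMap.ker (f.domRestrict X)) =
        Module.finrank F ↥(X ⊓ LinearMap.ker f) := by
      rw [LinearMap.ker_domRestrict, ← Submodule.finrank_map_subtype_eq,
        Submodule.map_comap_subtype]
    have hrange := (LinearMap.range (f.domRestrict X)).finrank_le
    rw [Module.finrank_self] at hrange
    rw [← hker, ← (f.domRestrict X).finrank_range_add_finrank_ker]
    lia
  · simp [Module.finrank_of_not_finite hX]

namespace IsPolarSpace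

theorem isTotallySingular_sup_span_singleton (h : IsPolarSpace φ S)
    (hX : IsTotallySingular φ S X) (hy : y ∈ S) :
    IsTotallySingular φ S (X ⊓ LinearMap.ker (φ y) ⊔ Submodule.span F {y}) := by
  constructor
  · intro x hx
    obtain ⟨a, ⟨haX, hya⟩, _, hb, rfl⟩ := Submodule.mem_sup.1 hx
    obtain ⟨c, rfl⟩ := Submodule.mem_span_singleton.1 hb
    simpa using h.isCollinear (hX.1 haX) hy (h.isRefl _ _ hya) 1 c
  · intro x hx x' hx'
    obtain ⟨a, ⟨haX, hya⟩, _, hb, rfl⟩ := Submodule.mem_sup.1 hx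
    obtain ⟨c, rfl⟩ := Submodule.mem_span_singleton.1 hb
    obtain ⟨a', ⟨haX', hya'⟩, _, hb', rfl⟩ := Submodule.mem_sup.1 hx'
    obtain ⟨c', rfl⟩ := Submodule.mem_span_singleton.1 hb'
    rw [SetLike.mem_coe, LinearMap.mem_ker] at hya hya'
    simp [hX.2 a haX a' haX', h.isRefl _ _ hya, hya', h.apply_self hy]

theorem exists_isTotallySingular_mem (h : IsPolarSpace φ S) (hX : IsTotallySingular φ S X)
    (hy : y ∈ S) :
    ∃ Y, IsTotallySingular φ S Y ∧ y ∈ Y ∧ Module.finrank F X ≤ Module.finrank F Y := by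
  by_cases hyX : y ∈ X
  · exact ⟨X, hX, hyX, le_rfl⟩
  refine ⟨_, h.isTotallySingular_sup_span_singleton hX hy,
    Submodule.mem_sup_right (Submodule.mem_span_singleton_self y), ?_⟩
  by_cases hfin : FiniteDimensional F X
  · have hy0 : y ≠ 0 := fun hy0 => hyX (hy0 ▸ X.zero_mem)
    have hdisj : Disjoint (X ⊓ LinearMap.ker (φ y)) (Submodule.span F {y}) :=
      (Submodule.disjoint_span_singleton' hy0).2 fun hm => hyX hm.1
    have hfin' : FiniteDimensional F ↥(X ⊓ LinearMap.ker (φ y)) :=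
      Submodule.finiteDimensional_inf_left _ _
    calc Module.finrank F X ≤ Module.finrank F ↥(X ⊓ LinearMap.ker (φ y)) + 1 :=
          finrank_le_finrank_inf_ker_add_one X (φ y)
      _ = Module.finrank F ↥(X ⊓ LinearMap.ker (φ y)) +
          Module.finrank F (Submodule.span F {y}) := by rw [finrank_span_singleton hy0]
      _ = _ := by
        rw [← Submodule.finrank_sup_add_finrank_inf_eq, hdisj.eq_bot, finrank_bot, add_zero]
  · simp [Module.finrank_of_not_finite hfin]

theorem exists_isTotallySingular_inter_perpPair (h : IsPolarSpace φ S)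
    (hX : IsTotallySingular φ S X) (hy : y ∈ S) (z : V) :
    ∃ Y, IsTotallySingular φ (S ∩ perpPair φ y z) Y ∧
      Module.finrank F X ≤ Module.finrank F Y + 1 := by
  obtain ⟨Y, ⟨hYS, hYφ⟩, hyY, hXY⟩ := h.exists_isTotallySingular_mem hX hy
  refine ⟨Y ⊓ LinearMap.ker (φ z), ⟨fun x hx => ⟨hYS hx.1, mem_perpPair.2 ⟨hYφ y hyY x hx.1, hx.2⟩⟩,
    fun x hx x' hx' => hYφ x hx.1 x' hx'.1⟩, hXY.trans (finrank_le_finrank_inf_ker_add_one Y _)⟩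

theorem hasQuadrangles_of_one_lt_finrank (h : IsPolarSpace φ S) (hX : IsTotallySingular φ S X)
    (hX2 : 1 < Module.finrank F X) : HasQuadrangles F S := by
  refine h.hasQuadrangles fun y hy z _ _ => ?_
  obtain ⟨Y, hY, hXY⟩ := h.exists_isTotallySingular_inter_perpPair hX hy z
  have hY0 : Y ≠ ⊥ := by
    rintro rfl
    rw [finrank_bot] at hXY
    lia
  obtain ⟨u, hu, hu0⟩ := Y.exists_mem_ne_zero_of_ne_bot hY0
  exact ⟨u, hY.1 hu, hu0⟩

theorem hasQuadrangles_inter_perpPair (h : IsPolarSpace φ S) (hX : IsTotallySingular φ S X)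
    (hX3 : 2 < Module.finrank F X) (hy : y ∈ S) (hz : z ∈ S) (hyz : φ y z ≠ 0) :
    HasQuadrangles F (S ∩ perpPair φ y z) := by
  obtain ⟨Y, hY, hXY⟩ := h.exists_isTotallySingular_inter_perpPair hX hy z
  exact (h.inter_perpPair hy hz hyz).hasQuadrangles_of_one_lt_finrank hY (by lia)

end IsPolarSpace

end Rank

section AlternatingForms

variable {F V : Type*} [Field F] [AddCommGroup V] [Module F V] {σ : F →+* F}
  {φ : V →ₛₗ[σ] V →ₗ[F] F} {S : Set V} {A B : LinearMap.BilinForm F V} {f g : V →ₗ[F] F}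
  {p q y z : V}

theorem div_apply_comm (hA : A.IsAlt) (hB : B.IsAlt) (x y : V) :
    B x y / A x y = B y x / A y x := by
  rw [← hA.neg_eq y x, ← hB.neg_eq y x, neg_div_neg_eq]

namespace IsPolarSpace

theorem mul_eq_mul_of_orthogonal (h : IsPolarSpace φ S)
    (hquad : ∀ q ∈ S, φ p q ≠ 0 → HasQuadrangles F (S ∩ perpPair φ p q))
    (hp : p ∈ S) (hp0 : p ≠ 0) (hfp : f p = 0) (hgp : g p = 0)
    (hfg : ∀ v ∈ S, φ p v = 0 → f v = 0 → g v = 0)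
    (hy : y ∈ S) (hpy : φ p y = 0) (hz : z ∈ S) (hpz : φ p z = 0) :
    g y * f z = g z * f y := by
  obtain ⟨q, hq, hpq⟩ := h.exists_apply_ne_zero hp hp0
  obtain ⟨a, hya⟩ := h.exists_sub_smul_mem_inter_perpPair hp hpq hy hpy
  obtain ⟨b, hzb⟩ := h.exists_sub_smul_mem_inter_perpPair hp hpq hz hpz
  have hker : ∀ v ∈ S ∩ perpPair φ p q, f v = 0 → g v = 0 := fun v hv =>
    hfg v hv.1 (mem_perpPair.1 hv.2).1
  simpa [hfp, hgp] using (hquad q hq hpq).mul_eq_mul hker hya hzb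

theorem exists_orthogonal_ne_zero_and_ne_zero (h : IsPolarSpace φ S)
    (hquad : HasQuadrangles F (S ∩ perpPair φ p q)) (hp : p ∈ S) (hq : q ∈ S) (hpq : φ p q ≠ 0)
    (hfp : f p = 0) (hy : y ∈ S) (hpy : φ p y = 0) (hfy : f y ≠ 0)
    (hgq : g q = 0) (hz : z ∈ S) (hqz : φ q z = 0) (hgz : g z ≠ 0) :
    ∃ w ∈ S, φ p w = 0 ∧ φ q w = 0 ∧ f w ≠ 0 ∧ g w ≠ 0 := by
  obtain ⟨a, hya⟩ := h.exists_sub_smul_mem_inter_perpPair hp hpq hy hpy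
  obtain ⟨b, hzb⟩ :=
    h.exists_sub_smul_mem_inter_perpPair hq (h.apply_ne_zero_comm.1 hpq) hz hqz
  rw [perpPair_comm] at hzb
  obtain ⟨w, ⟨hw, hwpq⟩, hfw, hgw⟩ := hquad.exists_ne_zero_and_ne_zero (f := f) (g := g)
    hya (by simpa [hfp] using hfy) hzb (by simpa [hgq] using hgz)
  obtain ⟨hpw, hqw⟩ := mem_perpPair.1 hwpq
  exact ⟨w, hw, hpw, hqw, hfw, hgw⟩

theorem exists_orthogonal_not_orthogonal_ne_zero (h : IsPolarSpace φ S)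
    (hquad : ∀ q ∈ S, φ p q ≠ 0 → HasQuadrangles F (S ∩ perpPair φ p q))
    (hp : p ∈ S) (hp0 : p ≠ 0) (hq : q ∈ S) (hpq : φ p q = 0) (hqp : q ∉ Submodule.span F {p})
    (hfp : f p = 0) (hy : y ∈ S) (hpy : φ p y = 0) (hfy : f y ≠ 0) :
    ∃ w ∈ S, φ p w = 0 ∧ φ w q ≠ 0 ∧ f w ≠ 0 := by
  obtain ⟨p', hp', hpp'⟩ := h.exists_apply_ne_zero hp hp0
  obtain ⟨a, hya⟩ := h.exists_sub_smul_mem_inter_perpPair hp hpp' hy hpy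
  obtain ⟨b, hqb⟩ := h.exists_sub_smul_mem_inter_perpPair hp hpp' hq hpq
  have hqb0 : q - b • p ≠ 0 := fun h0 =>
    hqp (Submodule.mem_span_singleton.2 ⟨b, (sub_eq_zero.1 h0).symm⟩)
  obtain ⟨v, hv, hqv⟩ := (h.inter_perpPair hp hp' hpp').exists_apply_ne_zero hqb hqb0
  have hqv' : φ q v ≠ 0 := by simpa [(mem_perpPair.1 hv.2).1] using hqv
  obtain ⟨w, hw, hfw, hqw⟩ := (hquad p' hp' hpp').exists_ne_zero_and_ne_zero
    (f := f) (g := φ q) hya (by simpa [hfp] using hfy) hv hqv'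
  exact ⟨w, hw.1, (mem_perpPair.1 hw.2).1, h.apply_ne_zero_comm.1 hqw, hfw⟩

theorem div_eq_div_of_orthogonal (h : IsPolarSpace φ S)
    (hquad : ∀ q ∈ S, φ p q ≠ 0 → HasQuadrangles F (S ∩ perpPair φ p q))
    (hA : A.IsAlt) (hB : B.IsAlt) (hAB : ∀ v ∈ S, φ p v = 0 → A p v = 0 → B p v = 0)
    (hp : p ∈ S) (hy : y ∈ S) (hpy : φ p y = 0) (hApy : A p y ≠ 0)
    (hz : z ∈ S) (hpz : φ p z = 0) (hApz : A p z ≠ 0) :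
    B p y / A p y = B p z / A p z := by
  have hp0 : p ≠ 0 := by
    rintro rfl
    simp at hApy
  exact (div_eq_div_iff hApy hApz).2
    (h.mul_eq_mul_of_orthogonal hquad hp hp0 (hA p) (hB p) hAB hy hpy hz hpz)

theorem div_eq_div_of_not_orthogonal (h : IsPolarSpace φ S)
    (hquad : ∀ p ∈ S, ∀ q ∈ S, φ p q ≠ 0 → HasQuadrangles F (S ∩ perpPair φ p q))
    (hA : A.IsAlt) (hB : B.IsAlt)
    (hAB : ∀ x ∈ S, ∀ y ∈ S, φ x y = 0 → A x y = 0 → B x y = 0)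
    (hp : p ∈ S) (hy : y ∈ S) (hpy : φ p y = 0) (hApy : A p y ≠ 0)
    (hq : q ∈ S) (hz : z ∈ S) (hqz : φ q z = 0) (hAqz : A q z ≠ 0) (hpq : φ p q ≠ 0) :
    B p y / A p y = B q z / A q z := by
  obtain ⟨w, hw, hpw, hqw, hApw, hAqw⟩ := h.exists_orthogonal_ne_zero_and_ne_zero
    (hquad p hp q hq hpq) hp hq hpq (hA p) hy hpy hApy (hA q) hz hqz hAqz
  calc B p y / A p y = B p w / A p w :=
        h.div_eq_div_of_orthogonal (hquad p hp) hA hB (hAB p hp) hp hy hpy hApy hw hpw hApw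
    _ = B w p / A w p := div_apply_comm hA hB p w
    _ = B w q / A w q :=
        h.div_eq_div_of_orthogonal (hquad w hw) hA hB (hAB w hw) hw hp (h.isRefl _ _ hpw)
          (hA.isRefl.eq_iff.not.1 hApw) hq (h.isRefl _ _ hqw) (hA.isRefl.eq_iff.not.1 hAqw)
    _ = B q w / A q w := div_apply_comm hA hB w q
    _ = B q z / A q z :=
        h.div_eq_div_of_orthogonal (hquad q hq) hA hB (hAB q hq) hq hw hqw hAqw hz hqz hAqz

theorem div_eq_div (h : IsPolarSpace φ S)
    (hquad : ∀ p ∈ S, ∀ q ∈ S, φ p q ≠ 0 → HasQuadrangles F (S ∩ perpPair φ p q))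
    (hA : A.IsAlt) (hB : B.IsAlt)
    (hAB : ∀ x ∈ S, ∀ y ∈ S, φ x y = 0 → A x y = 0 → B x y = 0)
    (hp : p ∈ S) (hy : y ∈ S) (hpy : φ p y = 0) (hApy : A p y ≠ 0)
    (hq : q ∈ S) (hz : z ∈ S) (hqz : φ q z = 0) (hAqz : A q z ≠ 0) :
    B p y / A p y = B q z / A q z := by
  by_cases hpq : φ p q = 0
  swap
  · exact h.div_eq_div_of_not_orthogonal hquad hA hB hAB hp hy hpy hApy hq hz hqz hAqz hpq
  by_cases hqp : q ∈ Submodule.span F {p}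
  · obtain ⟨a, rfl⟩ := Submodule.mem_span_singleton.1 hqp
    have ha : a ≠ 0 := by
      rintro rfl
      simp at hAqz
    have hpz : φ p z = 0 := by simpa [ha] using hqz
    have hApz : A p z ≠ 0 := by simpa [ha] using hAqz
    simpa [mul_div_mul_left _ _ ha] using
      h.div_eq_div_of_orthogonal (hquad p hp) hA hB (hAB p hp) hp hy hpy hApy hz hpz hApz
  · have hp0 : p ≠ 0 := by
      rintro rfl
      simp at hApy
    obtain ⟨w, hw, hpw, hwq, hApw⟩ := h.exists_orthogonal_not_orthogonal_ne_zero
      (hquad p hp) hp hp0 hq hpq hqp (hA p) hy hpy hApy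
    calc B p y / A p y = B p w / A p w :=
          h.div_eq_div_of_orthogonal (hquad p hp) hA hB (hAB p hp) hp hy hpy hApy hw hpw hApw
      _ = B w p / A w p := div_apply_comm hA hB p w
      _ = B q z / A q z :=
          h.div_eq_div_of_not_orthogonal hquad hA hB hAB hw hp (h.isRefl _ _ hpw)
            (hA.isRefl.eq_iff.not.1 hApw) hq hz hqz hAqz hwq

theorem exists_eq_mul_of_isAlt (h : IsPolarSpace φ S)
    (hquad : ∀ p ∈ S, ∀ q ∈ S, φ p q ≠ 0 → HasQuadrangles F (S ∩ perpPair φ p q))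
    (hA : A.IsAlt) (hB : B.IsAlt)
    (hAB : ∀ x ∈ S, ∀ y ∈ S, φ x y = 0 → A x y = 0 → B x y = 0) :
    ∃ c : F, ∀ x ∈ S, ∀ y ∈ S, φ x y = 0 → B x y = c * A x y := by
  by_cases hex : ∃ p ∈ S, ∃ y ∈ S, φ p y = 0 ∧ A p y ≠ 0
  · obtain ⟨p, hp, y, hy, hpy, hApy⟩ := hex
    refine ⟨B p y / A p y, fun q hq z hz hqz => ?_⟩
    by_cases hAqz : A q z = 0
    · rw [hAB q hq z hz hqz hAqz, hAqz, mul_zero]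
    · rw [h.div_eq_div hquad hA hB hAB hp hy hpy hApy hq hz hqz hAqz, div_mul_cancel₀ _ hAqz]
  · push Not at hex
    exact ⟨0, fun x hx y hy hxy => by simpa using hAB x hx y hy hxy (hex x hx y hy hxy)⟩

end IsPolarSpace

end AlternatingForms

section Codes

variable {F V : Type*} [Field F] [AddCommGroup V] [Module F V] {σ : F →+* F}
  {φ : V →ₛₗ[σ] V →ₗ[F] F} {S : Set V} {T : Set (Submodule F V)}

theorem isMinimalCode_projectiveCode {W : Type*} [AddCommGroup W] [Module F W] {Ω : Set (ℙ F W)}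
    (hΩ : ∀ ξ η : Module.Dual F W, (∀ P ∈ Ω, ξ P.rep = 0 → η P.rep = 0) →
      ∃ c : F, ∀ P ∈ Ω, η P.rep = c * ξ P.rep) :
    IsMinimalCode (projectiveCode Ω) := by
  rintro _ ⟨ξ, rfl⟩ _ ⟨η, rfl⟩ hsupp
  obtain ⟨c, hc⟩ := hΩ ξ η fun P hP => not_imp_not.1 (@hsupp ⟨P, hP⟩)
  exact ⟨c, funext fun P => hc P P.2⟩

theorem exists_rep_eq_smul_of_mem_grassmannImage {k : ℕ} {P : ℙ F (⋀[F]^k V)}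
    (hP : P ∈ grassmannImage k T) :
    ∃ v : Fin k → V, Submodule.span F (Set.range v) ∈ T ∧
      ∃ a : F, P.rep = a • exteriorPower.ιMulti F k v := by
  obtain ⟨v, -, hvT, hPv⟩ := hP
  rw [Projectivization.submodule_eq, Submodule.span_singleton_eq_span_singleton] at hPv
  obtain ⟨a, ha⟩ := hPv
  exact ⟨v, hvT, (a⁻¹ : Fˣ), by rw [← ha, ← Units.smul_def, inv_smul_smul]⟩

theorem exists_mem_grassmannImage_rep_eq_smul {k : ℕ} {v : Fin k → V}
    (hvT : Submodule.span F (Set.range v) ∈ T) (hv : exteriorPower.ιMulti F k v ≠ 0) :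
    ∃ P ∈ grassmannImage k T, ∃ a : Fˣ, P.rep = a • exteriorPower.ιMulti F k v := by
  have hli : LinearIndependent F v := by
    by_contra hli
    exact hv (AlternatingMap.map_linearDependent _ _ hli)
  obtain ⟨a, ha⟩ := Projectivization.exists_smul_eq_mk_rep F _ hv
  exact ⟨_, ⟨v, hli, hvT, Projectivization.submodule_mk _ hv⟩, a, ha.symm⟩

theorem isMinimalCode_polarGrassmannCode {k : ℕ}
    (hT : ∀ ξ η : Module.Dual F (⋀[F]^k V),
      (∀ v : Fin k → V, Submodule.span F (Set.range v) ∈ T →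
        ξ (exteriorPower.ιMulti F k v) = 0 → η (exteriorPower.ιMulti F k v) = 0) →
      ∃ c : F, ∀ v : Fin k → V, Submodule.span F (Set.range v) ∈ T →
        η (exteriorPower.ιMulti F k v) = c * ξ (exteriorPower.ιMulti F k v)) :
    IsMinimalCode (polarGrassmannCode k T) := by
  refine isMinimalCode_projectiveCode fun ξ η hξη => ?_
  obtain ⟨c, hc⟩ := hT ξ η fun v hv hξ => by
    by_contra hη
    have hv0 : exteriorPower.ιMulti F k v ≠ 0 := fun h0 => hη (by rw [h0, map_zero])
    obtain ⟨P, hP, a, ha⟩ := exists_mem_grassmannImage_rep_eq_smul hv hv0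
    have hPη := hξη P hP (by simp [ha, Units.smul_def, hξ])
    simp [ha, Units.smul_def, hη] at hPη
  refine ⟨c, fun P hP => ?_⟩
  obtain ⟨v, hv, a, ha⟩ := exists_rep_eq_smul_of_mem_grassmannImage hP
  rw [ha, map_smul, map_smul, hc v hv, smul_eq_mul, smul_eq_mul, mul_left_comm]

/-- The bilinear form `(x, y) ↦ ξ (x ∧ y)` on `V` corresponding to a linear form `ξ` on `⋀² V`. -/
def wedgeForm (ξ : Module.Dual F (⋀[F]^2 V)) : LinearMap.BilinForm F V :=
  (MultilinearMap.ofSubsingletonₗ F F V F (0 : Fin 1)).symm.toLinearMap ∘ₗ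
    AlternatingMap.toMultilinearMapLM ∘ₗ
      (ξ.compAlternatingMap (exteriorPower.ιMulti F 2)).curryLeft

theorem wedgeForm_apply (ξ : Module.Dual F (⋀[F]^2 V)) (x y : V) :
    wedgeForm ξ x y = ξ (exteriorPower.ιMulti F 2 ![x, y]) :=
  rfl

theorem wedgeForm_isAlt (ξ : Module.Dual F (⋀[F]^2 V)) : (wedgeForm ξ).IsAlt := fun x => by
  rw [wedgeForm_apply, AlternatingMap.map_eq_zero_of_eq _ _ (i := 0) (j := 1) rfl (by decide),
    map_zero]

theorem IsPolarSpace.isMinimalCode (h : IsPolarSpace φ S)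
    (hquad : ∀ p ∈ S, ∀ q ∈ S, φ p q ≠ 0 → HasQuadrangles F (S ∩ perpPair φ p q))
    (hT : ∀ x y, Submodule.span F {x, y} ∈ T ↔ x ∈ S ∧ y ∈ S ∧ φ x y = 0) :
    IsMinimalCode (polarGrassmannCode 2 T) := by
  have hrange (x y : V) :
      Submodule.span F (Set.range ![x, y]) ∈ T ↔ x ∈ S ∧ y ∈ S ∧ φ x y = 0 := by
    rw [← hT, Matrix.range_cons_cons_empty]
  refine isMinimalCode_polarGrassmannCode fun ξ η hξη => ?_
  obtain ⟨c, hc⟩ := h.exists_eq_mul_of_isAlt hquad (wedgeForm_isAlt ξ) (wedgeForm_isAlt η)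
    fun x hx y hy hxy => hξη ![x, y] ((hrange x y).2 ⟨hx, hy, hxy⟩)
  refine ⟨c, fun v hv => ?_⟩
  obtain ⟨x, y, rfl⟩ : ∃ x y, v = ![x, y] := ⟨v 0, v 1, by ext i; fin_cases i <;> rfl⟩
  obtain ⟨hx, hy, hxy⟩ := (hrange x y).1 hv
  exact hc x hx y hy hxy

theorem exists_mem_lt_finrank_of_lt_wittIndex {k : ℕ} (hk : k < wittIndex T) :
    ∃ X ∈ T, k < Module.finrank F X := by
  simpa using exists_lt_of_lt_csSup' hk

end Codes

section Forms

variable {F V : Type*} [Field F] [AddCommGroup V] [Module F V] {σ : F →+* F}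

theorem span_pair_mem_totallyIsotropic_iff {φ : V →ₛₗ[σ] V →ₗ[F] F} (hφ : φ.IsRefl) (x y : V) :
    Submodule.span F {x, y} ∈ totallyIsotropic φ ↔ φ x x = 0 ∧ φ y y = 0 ∧ φ x y = 0 := by
  have hx : x ∈ Submodule.span F {x, y} := Submodule.subset_span (by simp)
  have hy : y ∈ Submodule.span F {x, y} := Submodule.subset_span (by simp)
  refine ⟨fun h => ⟨h x hx x hx, h y hy y hy, h x hx y hy⟩, ?_⟩
  rintro ⟨hxx, hyy, hxy⟩ u hu v hv
  obtain ⟨a, b, rfl⟩ := Submodule.mem_span_pair.1 hu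
  obtain ⟨c, d, rfl⟩ := Submodule.mem_span_pair.1 hv
  simp [hxx, hyy, hxy, hφ x y hxy]

theorem polarBilin_eq_zero_of_mem_totallySingular {Q : QuadraticForm F V} {X : Submodule F V}
    (hX : X ∈ totallySingular Q) {x y : V} (hx : x ∈ X) (hy : y ∈ X) :
    QuadraticMap.polarBilin Q x y = 0 := by
  simp [QuadraticMap.polar, hX x hx, hX y hy, hX _ (X.add_mem hx hy)]

theorem span_pair_mem_totallySingular_iff (Q : QuadraticForm F V) (x y : V) :
    Submodule.span F {x, y} ∈ totallySingular Q ↔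
      Q x = 0 ∧ Q y = 0 ∧ QuadraticMap.polarBilin Q x y = 0 := by
  have hx : x ∈ Submodule.span F {x, y} := Submodule.subset_span (by simp)
  have hy : y ∈ Submodule.span F {x, y} := Submodule.subset_span (by simp)
  refine ⟨fun h => ⟨h x hx, h y hy, polarBilin_eq_zero_of_mem_totallySingular h hx hy⟩, ?_⟩
  rintro ⟨hQx, hQy, hxy⟩ u hu
  obtain ⟨a, b, rfl⟩ := Submodule.mem_span_pair.1 hu
  rw [QuadraticMap.polarBilin_apply_apply] at hxy
  simp [QuadraticMap.map_add, QuadraticMap.map_smul, hQx, hQy, QuadraticMap.polar_smul_left,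
    QuadraticMap.polar_smul_right, hxy]

theorem isPolarSpace_univ_of_isAlt {φ : LinearMap.BilinForm F V} (hφ : φ.IsAlt)
    (hn : φ.SeparatingLeft) : IsPolarSpace φ Set.univ where
  isRefl := hφ.isRefl
  smul_mem _ _ _ := trivial
  add_mem _ _ _ := trivial
  apply_self _ := hφ _
  exists_add_smul_mem _ _ _ := ⟨0, trivial⟩
  exists_apply_ne_zero := fun {x} _ hx0 => by
    simpa using mt (hn x) hx0

theorem exists_map_add_smul_eq_zero {Q : QuadraticForm F V} {x w : V} (hx : Q x = 0)
    (hxw : QuadraticMap.polar Q x w ≠ 0) : ∃ c : F, Q (w + c • x) = 0 := by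
  rw [QuadraticMap.polar_comm] at hxw
  refine ⟨-(Q w / QuadraticMap.polar Q w x), ?_⟩
  simp [QuadraticMap.map_add, QuadraticMap.map_smul, hx, QuadraticMap.polar_smul_right, hxw]

theorem isPolarSpace_of_radical_eq_bot {Q : QuadraticForm F V} (hn : Q.radical = ⊥) :
    IsPolarSpace (QuadraticMap.polarBilin Q) {x | Q x = 0} where
  isRefl x y hxy := by
    rw [QuadraticMap.polarBilin_apply_apply] at hxy ⊢
    rwa [QuadraticMap.polar_comm]
  smul_mem a x hx := by
    rw [Set.mem_ofPred_eq] at hx ⊢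
    simp [QuadraticMap.map_smul, hx]
  add_mem := fun {x y} hx hy hxy => by
    rw [Set.mem_ofPred_eq] at hx hy ⊢
    rw [QuadraticMap.polarBilin_apply_apply] at hxy
    simp [QuadraticMap.map_add, hx, hy, hxy]
  apply_self := fun {x} hx => by
    rw [Set.mem_ofPred_eq] at hx
    simp [hx]
  exists_add_smul_mem hx _ hxw := exists_map_add_smul_eq_zero hx hxw
  exists_apply_ne_zero := fun {x} hx hx0 => by
    obtain ⟨w, hw⟩ : ∃ w, QuadraticMap.polarBilin Q x w ≠ 0 := by
      by_contra! h0
      have hrad : x ∈ Q.radical := ⟨hx, LinearMap.ext h0⟩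
      exact hx0 (by simpa [hn] using hrad)
    obtain ⟨c, hc⟩ := exists_map_add_smul_eq_zero hx hw
    rw [Set.mem_ofPred_eq] at hx
    exact ⟨w + c • x, hc, by simpa [hx] using hw⟩

theorem exists_add_map_eq_of_map_eq_self (hσ : σ ≠ RingHom.id F) (hσ2 : ∀ a, σ (σ a) = a) {s : F}
    (hs : σ s = s) : ∃ t, t + σ t = s := by
  obtain ⟨t, ht⟩ : ∃ t, t + σ t ≠ 0 := by
    by_contra! h0
    have h2 : (1 : F) + 1 = 0 := by simpa using h0 1
    refine hσ (RingHom.ext fun a => ?_)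
    rw [RingHom.id_apply]
    linear_combination h0 a - a * h2
  refine ⟨s / (t + σ t) * t, ?_⟩
  rw [map_mul, map_div₀, map_add, hs, hσ2, add_comm (σ t) t]
  field_simp

theorem exists_apply_add_smul_self_eq_zero {h : V →ₛₗ[σ] V →ₗ[F] F} (hσ : σ ≠ RingHom.id F)
    (hσ2 : ∀ a, σ (σ a) = a) (hs : h.IsSymm) {x w : V} (hx : h x x = 0) (hxw : h x w ≠ 0) :
    ∃ c : F, h (w + c • x) (w + c • x) = 0 := by
  obtain ⟨t, ht⟩ := exists_add_map_eq_of_map_eq_self hσ hσ2 (s := -h w w) (by simp [hs.eq w w])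
  have hwx : h w x ≠ 0 := hs.isRefl.eq_iff.not.1 hxw
  obtain ⟨c, hct⟩ : ∃ c, c * h w x = t := ⟨t / h w x, div_mul_cancel₀ t hwx⟩
  have hct' : σ c * h x w = σ t := by rw [← hs.eq w x, ← hct, map_mul]
  refine ⟨c, ?_⟩
  simp only [map_add, LinearMap.add_apply, map_smulₛₗ, LinearMap.smul_apply, smul_eq_mul, hx,
    RingHom.id_apply]
  linear_combination hct + hct' + ht

theorem isPolarSpace_of_isSymm {h : V →ₛₗ[σ] V →ₗ[F] F} (hσ : σ ≠ RingHom.id F)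
    (hσ2 : ∀ a, σ (σ a) = a) (hs : h.IsSymm) (hn : h.SeparatingLeft) :
    IsPolarSpace h {x | h x x = 0} where
  isRefl := hs.isRefl
  smul_mem a x hx := by
    rw [Set.mem_ofPred_eq] at hx ⊢
    simp [hx]
  add_mem := fun {x y} hx hy hxy => by
    rw [Set.mem_ofPred_eq] at hx hy ⊢
    simp [hx, hy, hxy, hs.isRefl x y hxy]
  apply_self hx := hx
  exists_add_smul_mem hx _ hxw := exists_apply_add_smul_self_eq_zero hσ hσ2 hs hx hxw
  exists_apply_ne_zero := fun {x} hx hx0 => by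
    obtain ⟨w, hw⟩ : ∃ w, h x w ≠ 0 := by simpa using mt (hn x) hx0
    obtain ⟨c, hc⟩ := exists_apply_add_smul_self_eq_zero hσ hσ2 hs hx hw
    rw [Set.mem_ofPred_eq] at hx
    exact ⟨w + c • x, hc, by simpa [hx] using hw⟩

end Forms

/-- The bound on the Witt index is stated through a subspace, because `wittIndex` has the junk value
`0` when the dimensions of the totally isotropic subspaces are unbounded. -/
theorem proposition4p3_general {F V : Type*} [Field F] [AddCommGroup V] [Module F V] :
    (∀ φ : LinearMap.BilinForm F V, φ.IsAlt → φ.Nondegenerate →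
      IsMinimalCode (polarGrassmannCode 2 (totallyIsotropic φ))) ∧
    (∀ Q : QuadraticForm F V, Q.radical = ⊥ →
      (∃ X ∈ totallySingular Q, 3 ≤ Module.finrank F X) →
      IsMinimalCode (polarGrassmannCode 2 (totallySingular Q))) ∧
    (∀ σ : F →+* F, σ ≠ RingHom.id F → (∀ a, σ (σ a) = a) →
      ∀ h : V →ₛₗ[σ] V →ₗ[F] F, h.IsSymm → h.Nondegenerate →
      (∃ X ∈ totallyIsotropic h, 3 ≤ Module.finrank F X) →
      IsMinimalCode (polarGrassmannCode 2 (totallyIsotropic h))) := by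
  refine ⟨fun φ hφ hn => ?_, fun Q hn ⟨X, hX, hX3⟩ => ?_, fun σ hσ hσ2 h hs hn ⟨X, hX, hX3⟩ => ?_⟩
  · refine (isPolarSpace_univ_of_isAlt hφ hn.1).isMinimalCode (fun p _ q _ _ => ?_) fun x y => ?_
    · simpa using hasQuadrangles_coe (perpPair φ p q)
    · simp [span_pair_mem_totallyIsotropic_iff hφ.isRefl, hφ x, hφ y]
  · have hXS : IsTotallySingular (QuadraticMap.polarBilin Q) {x | Q x = 0} X :=
      ⟨hX, fun _ hx _ hy => polarBilin_eq_zero_of_mem_totallySingular hX hx hy⟩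
    have hQ := isPolarSpace_of_radical_eq_bot hn
    exact hQ.isMinimalCode
      (fun _ hp _ hq hpq => hQ.hasQuadrangles_inter_perpPair hXS hX3 hp hq hpq)
      (span_pair_mem_totallySingular_iff Q)
  · have hXS : IsTotallySingular h {x | h x x = 0} X := ⟨fun x hx => hX x hx x hx, hX⟩
    have hpolar := isPolarSpace_of_isSymm hσ hσ2 hs hn.1
    exact hpolar.isMinimalCode
      (fun _ hp _ hq hpq => hpolar.hasQuadrangles_inter_perpPair hXS hX3 hp hq hpq)
      (span_pair_mem_totallyIsotropic_iff hs.isRefl)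

theorem proposition4p3 {F V : Type*} [Field F] [Finite F] (hF : Nat.card F ≠ 2)
    [AddCommGroup V] [Module F V] [FiniteDimensional F V] :
    -- line symplectic Grassmann codes
    (∀ φ : LinearMap.BilinForm F V, φ.IsAlt → φ.Nondegenerate →
      2 ≤ wittIndex (totallyIsotropic φ) →
      IsMinimalCode (polarGrassmannCode 2 (totallyIsotropic φ))) ∧
    -- line orthogonal Grassmann codes
    (∀ Q : QuadraticForm F V, QuadraticMap.Nondegenerate (Q := Q) →
      3 ≤ wittIndex (totallySingular Q) →
      IsMinimalCode (polarGrassmannCode 2 (totallySingular Q))) ∧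
    -- line hermitian Grassmann codes
    (∀ σ : F →+* F, σ ≠ RingHom.id F → (∀ a, σ (σ a) = a) →
      ∀ h : V →ₛₗ[σ] V →ₗ[F] F, h.IsSymm → h.Nondegenerate →
      3 ≤ wittIndex (totallyIsotropic h) →
      IsMinimalCode (polarGrassmannCode 2 (totallyIsotropic h))) := by
  obtain ⟨halt, horth, hherm⟩ := proposition4p3_general (F := F) (V := V)
  exact ⟨fun φ hφ hn _ => halt φ hφ hn,
    fun Q hn hQ => horth Q hn.radical_eq_bot (exists_mem_lt_finrank_of_lt_wittIndex hQ),
    fun σ hσ hσ2 h hs hn hh =>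
      hherm σ hσ hσ2 h hs hn (exists_mem_lt_finrank_of_lt_wittIndex hh)⟩
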